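/- Let $a\le b$ be real numbers and let $f:[a,b]\to\mathbb R$ be a function. A gauge is a function $\delta:[a,b]\to\mathbb R$ with $\delta(x)>0$ for all $x\in[a,b]$. A tagged partition $P$ of $[a,b]$ consists of points $a=x_0<x_1<\dots<x_n=b$ and tags $c_i\in[x_{i-1},x_i]$, $i=1,\dots,n$ (with $n=0$ if $a=b$); it is $\delta$-fine if $[x_{i-1},x_i]\subset(c_i-\delta(c_i),c_i+\delta(c_i))$ for every $i$. For $g:[a,b]\to\mathbb R$ put $S(P,g)=\sum_{i=1}^n g(c_i)(x_i-x_{i-1})$. Let $A$ be the set of all pairs $\gamma=(P,\delta)$ in which $\delta$ is a gauge and $P$ is a $\delta$-fine tagged partition of $[a,b]$, directed by the relation: $(P,\delta)$ follows $(P_1,\delta_1)$ if $\delta(x)\le\delta_1(x)$ for all $x\in[a,b]$. A generalized sequence $u:A\to\mathbb R$ converges if there is $L\in\mathbb R$ such that for every $\varepsilon>0$ there is $\gamma_0\in A$ with $|u(\gamma)-L|<\varepsilon$ for every $\gamma\in A$ that follows $\gamma_0$. Then $f$ is Lebesgue integrable on $[a,b]$ (that is, $f$ is Lebesgue measurable and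 $\int_{[a,b]}|f|<\infty$) if and only if both generalized sequences $$I(\gamma)=S(P,f)\qquad\text{and}\qquad J(\gamma)=S(P,|f|),\qquad \gamma=(P,\delta)\in A,$$ are convergent. -/

import Mathlib

open Filter Topology MeasureTheory

namespace GenSeq

/-- A tagged partition `a = x₀ < x₁ < ⋯ < xₙ = b` of `[a, b]` with tags `cᵢ ∈ [xᵢ₋₁, xᵢ]`.
For `a < b` the conditions force `n ≥ 1`; `n = 0` occurs only if `a = b`. -/
structure TaggedPartition (a b : ℝ) where
  /-- the number of subintervals -/
  n : ℕ
  /-- the division points `x₀, …, xₙ` -/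
  x : Fin (n + 1) → ℝ
  /-- the tags; `c i` belongs to the subinterval from `x i.castSucc` to `x i.succ` -/
  c : Fin n → Set.Icc a b
  strictMono : StrictMono x
  left_eq : x 0 = a
  right_eq : x (Fin.last n) = b
  tag_mem : ∀ i : Fin n, (c i : ℝ) ∈ Set.Icc (x i.castSucc) (x i.succ)

/-- A gauge on `[a, b]` is a strictly positive function. -/
def IsGauge {a b : ℝ} (δ : Set.Icc a b → ℝ) : Prop :=
  ∀ t, 0 < δ t

/-- `P` is `δ`-fine: every subinterval is contained in the open interval of radius `δ(c)` about
its tag `c`. -/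
def TaggedPartition.IsFine {a b : ℝ} (P : TaggedPartition a b) (δ : Set.Icc a b → ℝ) : Prop :=
  ∀ i : Fin P.n, Set.Icc (P.x i.castSucc) (P.x i.succ) ⊆
    Set.Ioo ((P.c i : ℝ) - δ (P.c i)) ((P.c i : ℝ) + δ (P.c i))

/-- The Riemann sum `S(P, f)`. -/
def riemannSum {a b : ℝ} (P : TaggedPartition a b) (f : Set.Icc a b → ℝ) : ℝ :=
  ∑ i : Fin P.n, f (P.c i) * (P.x i.succ - P.x i.castSucc)

/-- The set `A` of pairs `(P, δ)` where `δ` is a gauge and `P` is a `δ`-fine tagged partition. -/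
structure FinePair (a b : ℝ) where
  /-- the tagged partition -/
  P : TaggedPartition a b
  /-- the gauge -/
  δ : Set.Icc a b → ℝ
  isGauge : IsGauge δ
  isFine : P.IsFine δ

/-- `(P, δ)` follows `(P₁, δ₁)` if `δ ≤ δ₁` pointwise on `[a, b]`. -/
instance instPreorderFinePair (a b : ℝ) : Preorder (FinePair a b) where
  le γ₁ γ := ∀ t, γ.δ t ≤ γ₁.δ t
  le_refl _ _ := le_rfl
  le_trans _ _ _ h₁ h₂ t := (h₂ t).trans (h₁ t)

/-- Convergence of a generalized sequence of real numbers on the pairs `(P, δ)`. -/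
def Converges {a b : ℝ} (u : FinePair a b → ℝ) : Prop :=
  ∃ L : ℝ, Tendsto u atTop (𝓝 L)

/-- The generalized sequence `I(γ) = S(P, f)`, `γ = (P, δ)`. -/
def sumI {a b : ℝ} (f : Set.Icc a b → ℝ) (γ : FinePair a b) : ℝ :=
  riemannSum γ.P f

/-- The generalized sequence `J(γ) = S(P, |f|)`, `γ = (P, δ)`. -/
def sumJ {a b : ℝ} (f : Set.Icc a b → ℝ) (γ : FinePair a b) : ℝ :=
  riemannSum γ.P (fun t => |f t|)

/-- Auxiliary: an initial segment `[a, t]` of `[a, b]` has a fine tagged partition. -/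
def FineUpTo {a b : ℝ} (δ : Set.Icc a b → ℝ) (t : ℝ) : Prop :=
  ∃ (n : ℕ) (x : Fin (n + 1) → ℝ) (c : Fin n → Set.Icc a b), StrictMono x ∧ x 0 = a ∧
    x (Fin.last n) = t ∧ (∀ i : Fin n, (c i : ℝ) ∈ Set.Icc (x i.castSucc) (x i.succ)) ∧
    ∀ i : Fin n, Set.Icc (x i.castSucc) (x i.succ) ⊆
      Set.Ioo ((c i : ℝ) - δ (c i)) ((c i : ℝ) + δ (c i))

theorem fineUpTo_self {a b : ℝ} (δ : Set.Icc a b → ℝ) : FineUpTo δ a :=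
  ⟨0, fun _ => a, Fin.elim0, fun i j h => absurd h (by omega), rfl, rfl, fun i => i.elim0,
    fun i => i.elim0⟩

theorem FineUpTo.step {a b : ℝ} {δ : Set.Icc a b → ℝ} {s t : ℝ} (h : FineUpTo δ s) (hst : s < t)
    (d : Set.Icc a b) (hd : (d : ℝ) ∈ Set.Icc s t)
    (hf : Set.Icc s t ⊆ Set.Ioo ((d : ℝ) - δ d) ((d : ℝ) + δ d)) : FineUpTo δ t := by
  obtain ⟨n, x, c, hx, h0, h1, hc, hfi⟩ := h
  refine ⟨n + 1, Fin.snoc (α := fun _ => ℝ) x t, Fin.snoc (α := fun _ => Set.Icc a b) c d,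
    ?_, ?_, ?_, ?_, ?_⟩
  · rw [Fin.strictMono_iff_lt_succ]
    intro i
    refine Fin.lastCases ?_ (fun j => ?_) i
    · simp [h1, hst]
    · rw [Fin.succ_castSucc, Fin.snoc_castSucc, Fin.snoc_castSucc]
      exact hx Fin.castSucc_lt_succ
  · rw [← Fin.castSucc_zero, Fin.snoc_castSucc, h0]
  · simp
  · intro i
    refine Fin.lastCases ?_ (fun j => ?_) i
    · simpa [h1] using hd
    · rw [Fin.succ_castSucc, Fin.snoc_castSucc, Fin.snoc_castSucc, Fin.snoc_castSucc]
      exact hc j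
  · intro i
    refine Fin.lastCases ?_ (fun j => ?_) i
    · simpa [h1] using hf
    · rw [Fin.succ_castSucc, Fin.snoc_castSucc, Fin.snoc_castSucc, Fin.snoc_castSucc]
      exact hfi j

/-- Cousin's lemma: every gauge admits a fine tagged partition. -/
theorem exists_isFine {a b : ℝ} (hab : a ≤ b) (δ : Set.Icc a b → ℝ) (hδ : IsGauge δ) :
    ∃ P : TaggedPartition a b, P.IsFine δ := by
  have key : FineUpTo δ b := by
    set S : Set ℝ := {t | t ∈ Set.Icc a b ∧ FineUpTo δ t} with hS
    have haS : a ∈ S := ⟨⟨le_rfl, hab⟩, fineUpTo_self δ⟩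
    have hbdd : BddAbove S := ⟨b, fun t ht => ht.1.2⟩
    have hm : sSup S ∈ Set.Icc a b :=
      ⟨le_csSup hbdd haS, csSup_le ⟨a, haS⟩ fun t ht => ht.1.2⟩
    obtain ⟨d, hd⟩ : ∃ d : Set.Icc a b, (d : ℝ) = sSup S := ⟨⟨_, hm⟩, rfl⟩
    have hpos := hδ d
    obtain ⟨s, hs, hsd⟩ := exists_lt_of_lt_csSup ⟨a, haS⟩
      (show (d : ℝ) - δ d < sSup S by linarith)
    have hsd' : s ≤ d := hd ▸ le_csSup hbdd hs
    have step : ∀ t, (d : ℝ) ≤ t → t < d + δ d → FineUpTo δ t := by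
      intro t hdt ht
      rcases (hsd'.trans hdt).eq_or_lt with h | h
      · exact h ▸ hs.2
      · exact hs.2.step h d ⟨hsd', hdt⟩ fun y hy => ⟨hsd.trans_le hy.1, hy.2.trans_lt ht⟩
    rcases lt_or_ge b ((d : ℝ) + δ d) with h | h
    · exact step b d.2.2 h
    · have h2 : (d : ℝ) + δ d / 2 ∈ S :=
        ⟨⟨by linarith [d.2.1], by linarith⟩, step _ (by linarith) (by linarith)⟩
      have := le_csSup hbdd h2
      linarith
  obtain ⟨n, x, c, hx, h0, h1, hc, hf⟩ := key
  exact ⟨⟨n, x, c, hx, h0, h1, hc⟩, hf⟩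

/-- The index set is non-empty. -/
theorem nonempty_finePair {a b : ℝ} (hab : a ≤ b) : Nonempty (FinePair a b) := by
  have h1 : IsGauge (fun _ : Set.Icc a b => (1 : ℝ)) := fun _ => one_pos
  obtain ⟨P, hP⟩ := exists_isFine hab _ h1
  exact ⟨⟨P, _, h1, hP⟩⟩

/-- The relation "follows" directs the index set. -/
instance instIsDirectedFinePair (a b : ℝ) : IsDirectedOrder (FinePair a b) where
  directed γ₁ γ₂ := by
    have hab : a ≤ b := by
      have h := γ₁.P.strictMono.monotone (Fin.zero_le (Fin.last γ₁.P.n))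
      rwa [γ₁.P.left_eq, γ₁.P.right_eq] at h
    have hδ : IsGauge (fun t => min (γ₁.δ t) (γ₂.δ t)) :=
      fun t => lt_min (γ₁.isGauge t) (γ₂.isGauge t)
    obtain ⟨P, hP⟩ := exists_isFine hab _ hδ
    exact ⟨⟨P, _, hδ, hP⟩, fun t => min_le_left _ _, fun t => min_le_right _ _⟩

/-- Convergence in the usual `ε`-form for generalized sequences. -/
theorem converges_iff {a b : ℝ} (hab : a ≤ b) (u : FinePair a b → ℝ) :
    Converges u ↔ ∃ L : ℝ, ∀ ε > 0, ∃ γ₀ : FinePair a b, ∀ γ, γ₀ ≤ γ → |u γ - L| < ε := by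
  have := nonempty_finePair hab
  simp [Converges, (atTop_basis (α := FinePair a b)).tendsto_iff Metric.nhds_basis_ball, Real.dist_eq]

end GenSeq

/-! Convergence of the Riemann sums along `FinePair` is gauge (Henstock–Kurzweil) integrability, so
the claim is that Lebesgue integrability of `f` amounts to gauge integrability of both `f` and
`|f|`.

Lebesgue to gauge: by Vitali–Carathéodory there is a lower semicontinuous `g > φ` with integral
below `∫ φ + ε`. Choosing `δ t` so that `g > φ t` within `δ t` of `t` bounds every fine sum by `∫ g`
(`exists_gauge_riemannSum_le`). Applying this to `φ` and `-φ` gives convergence.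

Gauge to Lebesgue: `|φ| + φ` and `|φ| - φ` are non-negative and gauge integrable, so their
primitives are monotone, hence differentiable a.e. with integrable derivative. Saks–Henstock and a
Besicovitch covering identify that derivative with the integrand a.e.
(`ae_eq_deriv_of_hasGaugeIntegral`), which yields measurability and integrability at once. -/

namespace GenSeq

open Set

/-! ### Riemann sums of fine partitions, built by concatenation -/

/-- `FineSum δ f u v s`: the number `s` is the Riemann sum of `f` over some `δ`-fine tagged
partition of `[u, v]`. -/
inductive FineSum (δ f : ℝ → ℝ) (u : ℝ) : ℝ → ℝ → Prop
  | nil : FineSum δ f u u 0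
  | snoc {v w c s : ℝ} : FineSum δ f u v s → v < w → c ∈ Icc v w →
      Icc v w ⊆ Ioo (c - δ c) (c + δ c) → FineSum δ f u w (s + f c * (w - v))

namespace FineSum

variable {δ δ' f : ℝ → ℝ} {u v w s t : ℝ}

theorem le (h : FineSum δ f u v s) : u ≤ v := by
  induction h with
  | nil => exact le_rfl
  | snoc _ hvw _ _ ih => exact ih.trans hvw.le

theorem append (h : FineSum δ f u v s) (h' : FineSum δ f v w t) : FineSum δ f u w (s + t) := by
  induction h' with
  | nil => simpa using h
  | snoc _ hvw hc hf ih =>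
    rw [← add_assoc]
    exact ih.snoc hvw hc hf

theorem mono (h : FineSum δ f u v s) (hδ : ∀ x, δ x ≤ δ' x) : FineSum δ' f u v s := by
  induction h with
  | nil => exact .nil
  | @snoc v w c s _ hvw hc hf ih =>
    exact ih.snoc hvw hc (hf.trans (Ioo_subset_Ioo (by linarith [hδ c]) (by linarith [hδ c])))

theorem nonneg (hf : ∀ x, 0 ≤ f x) (h : FineSum δ f u v s) : 0 ≤ s := by
  induction h with
  | nil => exact le_rfl
  | snoc _ hvw _ _ ih => exact add_nonneg ih (mul_nonneg (hf _) (sub_nonneg.2 hvw.le))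

theorem exists_of_pos (f : ℝ → ℝ) (hδ : ∀ x, 0 < δ x) (huv : u ≤ v) : ∃ s, FineSum δ f u v s := by
  obtain ⟨P, hP⟩ := exists_isFine huv (fun t : Icc u v => δ t) (fun t => hδ t)
  have key : ∀ i : Fin (P.n + 1), ∃ s, FineSum δ f u (P.x i) s := by
    intro i
    induction i using Fin.induction with
    | zero => exact ⟨0, by rw [P.left_eq]; exact .nil⟩
    | succ i ih =>
      obtain ⟨s, hs⟩ := ih
      exact ⟨_, hs.snoc (P.strictMono Fin.castSucc_lt_succ) (P.tag_mem i) (hP i)⟩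
  exact P.right_eq ▸ key (Fin.last _)

/-- The induction moves the right endpoint `v`, while the tags must stay in the fixed type `Icc a
b`; hence the separate bound `v ≤ b`. -/
theorem exists_partition {a b : ℝ} {g : Icc a b → ℝ} (hg : ∀ t : Icc a b, f t = g t)
    (h : FineSum δ f a v s) (hvb : v ≤ b) :
    ∃ (n : ℕ) (x : Fin (n + 1) → ℝ) (c : Fin n → Icc a b), StrictMono x ∧ x 0 = a ∧
      x (Fin.last n) = v ∧ (∀ i : Fin n, (c i : ℝ) ∈ Icc (x i.castSucc) (x i.succ)) ∧
      (∀ i : Fin n, Icc (x i.castSucc) (x i.succ) ⊆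
        Ioo ((c i : ℝ) - δ (c i)) ((c i : ℝ) + δ (c i))) ∧
      ∑ i : Fin n, g (c i) * (x i.succ - x i.castSucc) = s := by
  induction h with
  | nil =>
    exact ⟨0, fun _ => a, Fin.elim0, fun i j h => absurd h (by omega), rfl, rfl, fun i => i.elim0,
      fun i => i.elim0, by simp⟩
  | @snoc v w d s hs hvw hd hf ih =>
    obtain ⟨n, x, c, hx, h0, h1, hc, hfi, hsum⟩ := ih (hvw.le.trans hvb)
    obtain ⟨d, rfl⟩ : ∃ d' : Icc a b, (d' : ℝ) = d :=
      ⟨⟨d, hs.le.trans hd.1, hd.2.trans hvb⟩, rfl⟩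
    refine ⟨n + 1, Fin.snoc (α := fun _ => ℝ) x w, Fin.snoc (α := fun _ => Icc a b) c d,
      ?_, ?_, ?_, ?_, ?_, ?_⟩
    · rw [Fin.strictMono_iff_lt_succ]
      intro i
      refine Fin.lastCases ?_ (fun j => ?_) i
      · simp [h1, hvw]
      · rw [Fin.succ_castSucc, Fin.snoc_castSucc, Fin.snoc_castSucc]
        exact hx Fin.castSucc_lt_succ
    · rw [← Fin.castSucc_zero, Fin.snoc_castSucc, h0]
    · simp
    · intro i
      refine Fin.lastCases ?_ (fun j => ?_) i
      · simpa [h1] using hd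
      · rw [Fin.succ_castSucc, Fin.snoc_castSucc, Fin.snoc_castSucc, Fin.snoc_castSucc]
        exact hc j
    · intro i
      refine Fin.lastCases ?_ (fun j => ?_) i
      · simpa [h1] using hf
      · rw [Fin.succ_castSucc, Fin.snoc_castSucc, Fin.snoc_castSucc, Fin.snoc_castSucc]
        exact hfi j
    · rw [Fin.sum_univ_castSucc]
      simp [Fin.succ_castSucc, -Fin.castSucc_succ, h1, hsum, hg]

theorem exists_taggedPartition {a b : ℝ} {g : Icc a b → ℝ} (hg : ∀ t : Icc a b, f t = g t)
    (h : FineSum δ f a b s) :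
    ∃ P : TaggedPartition a b, P.IsFine (fun t => δ t) ∧ riemannSum P g = s := by
  obtain ⟨n, x, c, hx, h0, h1, hc, hf, hs⟩ := h.exists_partition hg le_rfl
  exact ⟨⟨n, x, c, hx, h0, h1, hc⟩, hf, hs⟩

end FineSum

/-! ### The gauge integral: additivity, subintervals, primitives -/

/-- The function `f` has gauge integral `I` over `[u, v]`. -/
def HasGaugeIntegral (f : ℝ → ℝ) (u v I : ℝ) : Prop :=
  ∀ ε > 0, ∃ δ : ℝ → ℝ, (∀ x, 0 < δ x) ∧ ∀ s, FineSum δ f u v s → |s - I| ≤ ε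

namespace HasGaugeIntegral

variable {f : ℝ → ℝ} {a b u v w I J K : ℝ}

theorem exists_fineSum (h : HasGaugeIntegral f u v I) (huv : u ≤ v) {δ : ℝ → ℝ}
    (hδ : ∀ x, 0 < δ x) {η : ℝ} (hη : 0 < η) : ∃ s, FineSum δ f u v s ∧ |s - I| ≤ η := by
  obtain ⟨δ', hδ', h'⟩ := h η hη
  obtain ⟨s, hs⟩ := FineSum.exists_of_pos (δ := fun x => min (δ x) (δ' x)) f
    (fun x => lt_min (hδ x) (hδ' x)) huv
  exact ⟨s, hs.mono fun x => min_le_left _ _, h' s (hs.mono fun x => min_le_right _ _)⟩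

theorem nonneg (h : HasGaugeIntegral f u v I) (huv : u ≤ v) (hf : ∀ x, 0 ≤ f x) : 0 ≤ I := by
  refine le_of_forall_pos_le_add fun ε hε => ?_
  obtain ⟨s, hs, hsI⟩ := h.exists_fineSum huv (fun _ => one_pos) hε
  linarith [hs.nonneg hf, (abs_le.1 hsI).2]

theorem eq_add (hI : HasGaugeIntegral f u v I) (hJ : HasGaugeIntegral f v w J)
    (hK : HasGaugeIntegral f u w K) (huv : u ≤ v) (hvw : v ≤ w) : K = I + J := by
  refine eq_of_abs_sub_le_all fun ε hε => ?_
  obtain ⟨δ, hδ, h⟩ := hK (ε / 3) (by positivity)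
  obtain ⟨s, hs, hsI⟩ := hI.exists_fineSum huv hδ (η := ε / 3) (by positivity)
  obtain ⟨t, ht, htJ⟩ := hJ.exists_fineSum hvw hδ (η := ε / 3) (by positivity)
  have := abs_le.1 (h _ (hs.append ht))
  have h1 := abs_le.1 hsI
  have h2 := abs_le.1 htJ
  exact abs_le.2 ⟨by linarith, by linarith⟩

/-- Cauchy criterion: two fine sums over `[u, v]`, completed by the same fine sums over `[a, u]` and
`[v, b]`, become sums over `[a, b]` close to `I`, so they are close to each other. -/
theorem exists_subinterval (h : HasGaugeIntegral f a b I) (hau : a ≤ u) (huv : u ≤ v)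
    (hvb : v ≤ b) : ∃ J, HasGaugeIntegral f u v J := by
  set l : Filter ℝ := ⨅ (δ : ℝ → ℝ) (_ : ∀ x, 0 < δ x), 𝓟 {s | FineSum δ f u v s} with hl
  have hb : l.HasBasis (fun δ : ℝ → ℝ => ∀ x, 0 < δ x) fun δ => {s | FineSum δ f u v s} := by
    refine hasBasis_biInf_principal' (fun δ hδ δ' hδ' => ?_) ⟨fun _ => 1, fun _ => one_pos⟩
    exact ⟨fun x => min (δ x) (δ' x), fun x => lt_min (hδ x) (hδ' x),
      fun s hs => FineSum.mono hs fun x => min_le_left _ _,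
      fun s hs => FineSum.mono hs fun x => min_le_right _ _⟩
  have hcau : Cauchy l := by
    rw [Metric.cauchy_iff]
    refine ⟨hb.neBot_iff.2 fun hδ => FineSum.exists_of_pos f hδ huv, fun ε hε => ?_⟩
    obtain ⟨δ, hδ, h'⟩ := h (ε / 3) (by positivity)
    refine ⟨_, hb.mem_of_mem hδ, fun s hs t ht => ?_⟩
    obtain ⟨p, hp⟩ := FineSum.exists_of_pos f hδ hau
    obtain ⟨q, hq⟩ := FineSum.exists_of_pos f hδ hvb
    have h1 := abs_le.1 (h' _ ((hp.append hs).append hq))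
    have h2 := abs_le.1 (h' _ ((hp.append ht).append hq))
    rw [Real.dist_eq, abs_lt]
    constructor <;> linarith
  obtain ⟨J, hJ⟩ := CompleteSpace.complete hcau
  refine ⟨J, fun ε hε => ?_⟩
  obtain ⟨δ, hδ, h'⟩ := hb.mem_iff.1 (hJ (Metric.closedBall_mem_nhds J hε))
  exact ⟨δ, hδ, fun s hs => by simpa [Real.dist_eq] using h' hs⟩

theorem exists_primitive (h : HasGaugeIntegral f a b I) :
    ∃ F : ℝ → ℝ, ∀ u v, a ≤ u → u ≤ v → v ≤ b → HasGaugeIntegral f u v (F v - F u) := by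
  have h1 : ∀ x, ∃ J, a ≤ x → x ≤ b → HasGaugeIntegral f a x J := by
    intro x
    by_cases hx : a ≤ x ∧ x ≤ b
    · obtain ⟨J, hJ⟩ := h.exists_subinterval le_rfl hx.1 hx.2
      exact ⟨J, fun _ _ => hJ⟩
    · exact ⟨0, fun h1 h2 => absurd ⟨h1, h2⟩ hx⟩
  choose F hF using h1
  refine ⟨F, fun u v hau huv hvb => ?_⟩
  obtain ⟨J, hJ⟩ := h.exists_subinterval hau huv hvb
  have := (hF u hau (huv.trans hvb)).eq_add hJ (hF v (hau.trans huv) hvb) hau huv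
  rwa [this, add_sub_cancel_left]

end HasGaugeIntegral

/-! ### Saks–Henstock and differentiation of the primitive -/

/-- **Saks–Henstock lemma**, approximate form: the deviations over finitely many disjoint `δ`-fine
closed balls sum up to the deviation of a `δ`-fine partition, up to an arbitrarily small error. -/
theorem exists_fineSum_of_disjoint_closedBall {f F δ r : ℝ → ℝ} {a b : ℝ}
    (hF : ∀ u v, a ≤ u → u ≤ v → v ≤ b → HasGaugeIntegral f u v (F v - F u))
    (hδ : ∀ x, 0 < δ x) (t : Finset ℝ) (hr : ∀ x ∈ t, 0 < r x ∧ r x < δ x ∧ a ≤ x - r x)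
    (hd : (t : Set ℝ).PairwiseDisjoint fun x => Metric.closedBall x (r x)) {v : ℝ} (hav : a ≤ v)
    (hvb : v ≤ b) (htv : ∀ x ∈ t, x + r x ≤ v) {η : ℝ} (hη : 0 < η) :
    ∃ s, FineSum δ f a v s ∧ |s - (F v - F a) -
      ∑ x ∈ t, (f x * (2 * r x) - (F (x + r x) - F (x - r x)))| ≤ η := by
  -- Remove the rightmost centre `m`. The ball about `m` is a single interval tagged by `m`; the
  -- part left of `m - r m` and the gap `[m + r m, v]` each cost `η / 2`.
  induction t using Finset.induction_on_max generalizing v η with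
  | empty =>
    obtain ⟨s, hs, h⟩ := (hF a v le_rfl hav hvb).exists_fineSum hav hδ hη
    exact ⟨s, hs, by simpa using h⟩
  | insert m t hm ih =>
    obtain ⟨hr0, hrδ, har⟩ := hr m (Finset.mem_insert_self _ _)
    have hmv := htv m (Finset.mem_insert_self _ _)
    have hsep : ∀ x ∈ t, x + r x ≤ m - r m := by
      intro x hx
      have hrx := (hr x (Finset.mem_insert_of_mem hx)).1
      have hxm := hm x hx
      -- Otherwise `max x (m - r m)` lies in both balls.
      by_contra! hlt
      refine Set.disjoint_left.1 (hd (Finset.mem_coe.2 (Finset.mem_insert_of_mem hx))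
        (Finset.mem_coe.2 (Finset.mem_insert_self m t)) hxm.ne)
        (show max x (m - r m) ∈ _ from ?_) ?_
      · simp only [Real.closedBall_eq_Icc]
        exact ⟨le_max_of_le_left (by linarith), max_le (by linarith) hlt.le⟩
      · simp only [Real.closedBall_eq_Icc]
        exact ⟨le_max_right _ _, max_le (by linarith) (by linarith)⟩
    obtain ⟨s, hs, h1⟩ := ih (fun x hx => hr x (Finset.mem_insert_of_mem hx))
      (hd.subset (by simp)) har (by linarith) hsep (half_pos hη)
    obtain ⟨s', hs', h2⟩ := (hF (m + r m) v (by linarith) hmv hvb).exists_fineSum hmv hδ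
      (half_pos hη)
    refine ⟨_, (hs.snoc (w := m + r m) (c := m) (by linarith) ⟨by linarith, by linarith⟩
      fun y hy => ⟨by linarith [hy.1], by linarith [hy.2]⟩).append hs', ?_⟩
    rw [Finset.sum_insert fun h => lt_irrefl _ (hm m h)]
    have h1 := abs_le.1 h1
    have h2 := abs_le.1 h2
    exact abs_le.2 ⟨by linarith, by linarith⟩

/-- Almost all of `E` is covered by disjoint `δ`-fine balls, each of volume at most `1 / κ` times
its signed deviation. Saks–Henstock makes the total deviation at most `κ * ε`, so `E` has volume at
most `ε`. The factor `σ` selects the sign. -/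
theorem volume_eq_zero_of_deviation {f F : ℝ → ℝ} {a b κ σ : ℝ} {E : Set ℝ}
    (hF : ∀ u v, a ≤ u → u ≤ v → v ≤ b → HasGaugeIntegral f u v (F v - F u))
    (hE : E ⊆ Ioo a b) (hκ : 0 < κ) (hσ : |σ| ≤ 1)
    (h : ∀ x ∈ E, ∀ᶠ r in 𝓝[>] 0,
      κ * (2 * r) ≤ σ * (f x * (2 * r) - (F (x + r) - F (x - r)))) :
    volume E = 0 := by
  by_contra hne
  obtain ⟨x₀, hx₀⟩ : E.Nonempty := nonempty_iff_ne_empty.2 fun h => hne (by simp [h])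
  have hab : a ≤ b := ((hE hx₀).1.trans (hE hx₀).2).le
  have key : ∀ ε > 0, volume E ≤ ENNReal.ofReal ε := by
    intro ε hε
    -- The other `κ * ε / 2` is the error allowed in the Saks–Henstock lemma.
    obtain ⟨δ, hδ, hδs⟩ := hF a b le_rfl hab le_rfl (κ * ε / 2) (by positivity)
    obtain ⟨t, r, htc, htE, hr, hcov, hdisj⟩ :=
      Besicovitch.exists_disjoint_closedBall_covering_ae volume
        (fun x => {r | κ * (2 * r) ≤ σ * (f x * (2 * r) - (F (x + r) - F (x - r)))}) E
        (fun x hx d hd => by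
          obtain ⟨r, hr1, hr2⟩ := ((h x hx).and (Ioo_mem_nhdsGT hd)).exists
          exact ⟨r, hr1, hr2⟩)
        -- The balls must be `δ`-fine and stay inside `[a, b]`, where `F` is a primitive.
        (fun x => min (δ x) (min (x - a) (b - x)))
        (fun x hx => lt_min (hδ x)
          (lt_min (sub_pos.2 (hE hx).1) (sub_pos.2 (hE hx).2)))
    have hr' : ∀ x ∈ t, 0 < r x ∧ r x < δ x ∧ a ≤ x - r x ∧ x + r x ≤ b := by
      intro x hx
      obtain ⟨h0, h1⟩ := (hr x hx).2
      simp only [lt_min_iff] at h1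
      exact ⟨h0, h1.1, by linarith [h1.2.1], by linarith [h1.2.2]⟩
    have hfin : ∀ T : Finset ℝ, (T : Set ℝ) ⊆ t → ∑ x ∈ T, 2 * r x ≤ ε := by
      intro T hT
      obtain ⟨s, hs, hs'⟩ := exists_fineSum_of_disjoint_closedBall hF hδ T
        (fun x hx => ⟨(hr' x (hT hx)).1, (hr' x (hT hx)).2.1, (hr' x (hT hx)).2.2.1⟩)
        (hdisj.subset hT) hab le_rfl (fun x hx => (hr' x (hT hx)).2.2.2)
        (η := κ * ε / 2) (by positivity)
      have h1 := abs_le.1 (hδs s hs)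
      have h2 := abs_le.1 hs'
      have h3 : κ * ∑ x ∈ T, 2 * r x ≤
          σ * ∑ x ∈ T, (f x * (2 * r x) - (F (x + r x) - F (x - r x))) := by
        rw [Finset.mul_sum, Finset.mul_sum]
        exact Finset.sum_le_sum fun x hx => (hr x (hT hx)).1
      have h4 : |∑ x ∈ T, (f x * (2 * r x) - (F (x + r x) - F (x - r x)))| ≤ κ * ε :=
        abs_le.2 ⟨by linarith, by linarith⟩
      have h5 := (le_abs_self _).trans_eq (abs_mul σ
        (∑ x ∈ T, (f x * (2 * r x) - (F (x + r x) - F (x - r x)))))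
      have h6 := mul_le_mul hσ h4 (abs_nonneg _) zero_le_one
      exact le_of_mul_le_mul_left (by linarith) hκ
    calc volume E ≤ volume (⋃ x ∈ t, Metric.closedBall x (r x)) :=
          measure_mono_ae (ae_le_set.2 hcov)
      _ ≤ ∑' x : t, volume (Metric.closedBall (x : ℝ) (r x)) := measure_biUnion_le _ htc _
      _ ≤ ENNReal.ofReal ε := by
          rw [ENNReal.tsum_eq_iSup_sum]
          refine iSup_le fun T => ?_
          simp only [Real.volume_closedBall]
          rw [← ENNReal.ofReal_sum_of_nonneg
            fun (x : t) _ => mul_nonneg zero_le_two (hr' x x.2).1.le]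
          refine ENNReal.ofReal_le_ofReal ?_
          have := hfin (T.map (Function.Embedding.subtype _)) (by simp)
          simpa using this
  refine hne (le_antisymm (ENNReal.le_of_forall_pos_le_add fun ε hε _ => ?_) zero_le)
  simpa using key ε hε

/-- The primitive of a gauge integrable function has that function as its derivative at almost
every point of differentiability. -/
theorem ae_eq_deriv_of_hasGaugeIntegral {f F : ℝ → ℝ} {a b : ℝ}
    (hF : ∀ u v, a ≤ u → u ≤ v → v ≤ b → HasGaugeIntegral f u v (F v - F u)) :
    ∀ᵐ x, x ∈ Ioo a b → DifferentiableAt ℝ F x → f x = deriv F x := by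
  set E : ℝ → ℕ → Set ℝ := fun σ k =>
    {x | x ∈ Ioo a b ∧ DifferentiableAt ℝ F x ∧ 1 / ((k : ℝ) + 1) < σ * (f x - deriv F x)} with hEdef
  have hE : ∀ σ : ℝ, |σ| ≤ 1 → ∀ k, volume (E σ k) = 0 := by
    intro σ hσ k
    have hk : 0 < 1 / ((k : ℝ) + 1) := by positivity
    refine volume_eq_zero_of_deviation hF (fun x hx => hx.1) (half_pos hk) hσ fun x hx => ?_
    obtain ⟨-, hdiff, hlt⟩ := hx
    set κ := 1 / ((k : ℝ) + 1)
    -- An error `κ / 2 * r` at each of `x + r` and `x - r` costs `κ * r` out of `κ * (2 * r)`,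
    -- leaving `κ / 2 * (2 * r)`.
    have ho := (hasDerivAt_iff_isLittleO.1 hdiff.hasDerivAt).def (half_pos hk)
    obtain ⟨ρ, hρ, hball⟩ := Metric.eventually_nhds_iff.1 ho
    filter_upwards [Ioo_mem_nhdsGT hρ] with r hr
    have h1 := hball (y := x + r) (by simpa [Real.dist_eq, abs_of_pos hr.1] using hr.2)
    have h2 := hball (y := x - r) (by simpa [Real.dist_eq, abs_of_pos hr.1] using hr.2)
    simp only [add_sub_cancel_left, sub_sub_cancel_left, smul_eq_mul, Real.norm_eq_abs, abs_neg,
      abs_of_pos hr.1] at h1 h2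
    have h1 := abs_le.1 h1
    have h2 := abs_le.1 h2
    have h3 : |2 * r * deriv F x - (F (x + r) - F (x - r))| ≤ κ * r :=
      abs_le.2 ⟨by linarith, by linarith⟩
    have h4 := (neg_abs_le (σ * (2 * r * deriv F x - (F (x + r) - F (x - r)))))
    rw [abs_mul] at h4
    have h5 := mul_le_mul hσ h3 (abs_nonneg _) zero_le_one
    have h6 := mul_le_mul_of_nonneg_right hlt.le (mul_nonneg zero_le_two hr.1.le)
    linarith
  have hE1 : ∀ᵐ x, ∀ k, x ∉ E 1 k :=
    ae_all_iff.2 fun k => measure_eq_zero_iff_ae_notMem.1 (hE 1 (by simp) k)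
  have hE2 : ∀ᵐ x, ∀ k, x ∉ E (-1) k :=
    ae_all_iff.2 fun k => measure_eq_zero_iff_ae_notMem.1 (hE (-1) (by simp) k)
  filter_upwards [hE1, hE2] with x hx1 hx2 hx hdiff
  by_contra hne
  rcases lt_or_gt_of_ne hne with hlt | hlt
  · obtain ⟨k, hk⟩ := exists_nat_one_div_lt (sub_pos.2 hlt)
    exact hx2 k ⟨hx, hdiff, by linarith⟩
  · obtain ⟨k, hk⟩ := exists_nat_one_div_lt (sub_pos.2 hlt)
    exact hx1 k ⟨hx, hdiff, by linarith⟩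

/-- A non-negative gauge integrable function is Lebesgue integrable. -/
theorem HasGaugeIntegral.integrableOn {f : ℝ → ℝ} {a b I : ℝ} (hab : a ≤ b)
    (h : HasGaugeIntegral f a b I) (hf : ∀ x, 0 ≤ f x) : IntegrableOn f (Icc a b) := by
  obtain ⟨F, hF⟩ := h.exists_primitive
  have hmono : MonotoneOn F (Icc a b) := fun u hu v hv huv =>
    sub_nonneg.1 ((hF u v hu.1 huv hv.2).nonneg huv hf)
  have hint : IntegrableOn (deriv F) (Ioo a b) := by
    have := (uIcc_of_le hab ▸ hmono : MonotoneOn F (uIcc a b)).intervalIntegrable_deriv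
    exact ((intervalIntegrable_iff_integrableOn_Ioo_of_le hab).1 this)
  rw [integrableOn_Icc_iff_integrableOn_Ioo]
  refine hint.congr_fun_ae ?_
  rw [EventuallyEq, ae_restrict_iff' measurableSet_Ioo]
  filter_upwards [ae_eq_deriv_of_hasGaugeIntegral hF, hmono.ae_differentiableWithinAt_of_mem]
    with x hx hd hxab
  exact (hx hxab ((hd (Ioo_subset_Icc_self hxab)).differentiableAt
    (Icc_mem_nhds hxab.1 hxab.2))).symm

/-! ### Lebesgue integrable functions: convergence of Riemann sums -/

theorem sum_succ_sub_castSucc {n : ℕ} (y : Fin (n + 1) → ℝ) :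
    ∑ i : Fin n, (y i.succ - y i.castSucc) = y (Fin.last n) - y 0 := by
  induction n with
  | zero => simp
  | succ n ih =>
    rw [Fin.sum_univ_castSucc]
    simp only [Fin.succ_castSucc]
    rw [ih fun i => y i.castSucc]
    simp

theorem TaggedPartition.IsFine.mono {a b : ℝ} {P : TaggedPartition a b} {δ δ' : Icc a b → ℝ}
    (h : P.IsFine δ) (hδ : ∀ t, δ t ≤ δ' t) : P.IsFine δ' := fun i =>
  (h i).trans (Ioo_subset_Ioo (by linarith [hδ (P.c i)]) (by linarith [hδ (P.c i)]))

/-- An integrable function has a gauge whose fine Riemann sums exceed its integral by at most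
`ε`. -/
theorem exists_gauge_riemannSum_le {a b : ℝ} (hab : a ≤ b) {φ : ℝ → ℝ}
    (hφ : IntegrableOn φ (Icc a b)) {ε : ℝ} (hε : 0 < ε) :
    ∃ δ : Icc a b → ℝ, IsGauge δ ∧ ∀ P : TaggedPartition a b, P.IsFine δ →
      riemannSum P (fun t => φ t) < (∫ x in Icc a b, φ x) + ε := by
  -- Vitali–Carathéodory; lower semicontinuity of `g` at `t` then supplies the gauge.
  obtain ⟨g, hfg, hg, hint, hfin, hlt⟩ := exists_lt_lowerSemicontinuous_integral_lt φ hφ hε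
  have hδ : ∀ t : Icc a b, ∃ d > 0, ∀ y, dist y (t : ℝ) < d → (φ t : EReal) < g y := fun t =>
    Metric.eventually_nhds_iff.1 (hg t _ (hfg t))
  choose δ hδ0 hδ using hδ
  refine ⟨δ, hδ0, fun P hP => lt_of_le_of_lt ?_ hlt⟩
  set G : ℝ → ℝ := fun x => (g x).toReal
  have hmem : ∀ i, P.x i ∈ Icc a b := fun i =>
    ⟨P.left_eq.symm.trans_le (P.strictMono.monotone (Fin.zero_le i)),
      (P.strictMono.monotone (Fin.le_last i)).trans_eq P.right_eq⟩
  have hii : ∀ u ∈ Icc a b, ∀ v ∈ Icc a b, IntervalIntegrable G volume u v := fun u hu v hv =>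
    IntegrableOn.intervalIntegrable
      ((show IntegrableOn G (Icc a b) volume from hint).mono_set (uIcc_subset_Icc hu hv))
  have ha : a ∈ Icc a b := left_mem_Icc.2 hab
  have hterm : ∀ i : Fin P.n, φ (P.c i) * (P.x i.succ - P.x i.castSucc) ≤
      (∫ y in a..P.x i.succ, G y) - ∫ y in a..P.x i.castSucc, G y := by
    intro i
    rw [intervalIntegral.integral_interval_sub_left (hii _ ha _ (hmem _)) (hii _ ha _ (hmem _))]
    have hconst : φ (P.c i) * (P.x i.succ - P.x i.castSucc) =
        ∫ _ in P.x i.castSucc..P.x i.succ, φ (P.c i) := by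
      rw [intervalIntegral.integral_const, smul_eq_mul, mul_comm]
    rw [hconst]
    refine intervalIntegral.integral_mono_ae_restrict (P.strictMono Fin.castSucc_lt_succ).le
      intervalIntegrable_const (hii _ (hmem _) _ (hmem _)) ?_
    have hsub : Icc (P.x i.castSucc) (P.x i.succ) ⊆ Icc a b :=
      Icc_subset_Icc (hmem _).1 (hmem _).2
    filter_upwards [ae_restrict_of_ae_restrict_of_subset hsub hfin, ae_restrict_mem measurableSet_Icc]
      with y hy hyi
    have hyP := hP i hyi
    have hlt := hδ (P.c i) y
      (by rw [Real.dist_eq, abs_lt]; exact ⟨by linarith [hyP.1], by linarith [hyP.2]⟩)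
    simpa using EReal.toReal_le_toReal hlt.le (EReal.coe_ne_bot _) hy.ne
  calc riemannSum P (fun t => φ t)
      ≤ ∑ i : Fin P.n, ((∫ y in a..P.x i.succ, G y) - ∫ y in a..P.x i.castSucc, G y) :=
        Finset.sum_le_sum fun i _ => hterm i
    _ = ∫ x in Icc a b, G x := by
        rw [sum_succ_sub_castSucc fun i => ∫ y in a..P.x i, G y, P.left_eq, P.right_eq,
          intervalIntegral.integral_same, sub_zero, intervalIntegral.integral_of_le hab,
          integral_Icc_eq_integral_Ioc]

theorem riemannSum_neg {a b : ℝ} (P : TaggedPartition a b) (g : Icc a b → ℝ) :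
    riemannSum P (fun t => -g t) = -riemannSum P g := by
  simp [riemannSum]

/-- The Riemann sums of an integrable function converge to its integral along the fine pairs. -/
theorem tendsto_riemannSum {a b : ℝ} (hab : a ≤ b) {φ : ℝ → ℝ}
    (hφ : IntegrableOn φ (Icc a b)) :
    Tendsto (fun γ : FinePair a b => riemannSum γ.P (fun t => φ t)) atTop
      (𝓝 (∫ x in Icc a b, φ x)) := by
  have := nonempty_finePair hab
  rw [(atTop_basis (α := FinePair a b)).tendsto_iff Metric.nhds_basis_ball]
  intro ε hε
  obtain ⟨δ₁, hδ₁, h₁⟩ := exists_gauge_riemannSum_le hab hφ hε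
  obtain ⟨δ₂, hδ₂, h₂⟩ := exists_gauge_riemannSum_le hab hφ.neg hε
  have hδ : IsGauge (fun t => min (δ₁ t) (δ₂ t)) := fun t => lt_min (hδ₁ t) (hδ₂ t)
  obtain ⟨P, hP⟩ := exists_isFine hab _ hδ
  refine ⟨⟨P, _, hδ, hP⟩, trivial, fun γ hγ => ?_⟩
  have hle : ∀ t, γ.δ t ≤ min (δ₁ t) (δ₂ t) := hγ
  have h1 := h₁ γ.P (γ.isFine.mono fun t => (hle t).trans (min_le_left _ _))
  have h2 := h₂ γ.P (γ.isFine.mono fun t => (hle t).trans (min_le_right _ _))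
  simp only [Pi.neg_apply, riemannSum_neg, integral_neg] at h2
  rw [Metric.mem_ball, Real.dist_eq, abs_lt]
  constructor <;> linarith

/-! ### Passage between `[a, b]` and the line; the equivalence -/

theorem hasGaugeIntegral_of_tendsto {a b L : ℝ} (hab : a ≤ b) {φ : ℝ → ℝ} {g : Icc a b → ℝ}
    (hg : ∀ t : Icc a b, φ t = g t)
    (h : Tendsto (fun γ : FinePair a b => riemannSum γ.P g) atTop (𝓝 L)) :
    HasGaugeIntegral φ a b L := by
  have := nonempty_finePair hab
  rw [(atTop_basis (α := FinePair a b)).tendsto_iff Metric.nhds_basis_ball] at h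
  intro ε hε
  obtain ⟨γ₀, -, hγ₀⟩ := h ε hε
  have hext : ∀ t : Icc a b, Function.extend Subtype.val γ₀.δ 1 (t : ℝ) = γ₀.δ t := fun t =>
    Subtype.val_injective.extend_apply _ _ t
  -- The default value `1` keeps the gauge positive off `[a, b]`.
  refine ⟨Function.extend Subtype.val γ₀.δ 1, fun x => ?_, fun s hs => ?_⟩
  · by_cases hx : x ∈ Icc a b
    · exact (hext ⟨x, hx⟩).symm ▸ γ₀.isGauge _
    · rw [Function.extend_apply' _ _ _ (by rintro ⟨t, rfl⟩; exact hx t.2)]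
      exact one_pos
  · obtain ⟨P, hP, rfl⟩ := hs.exists_taggedPartition hg
    simp only [hext] at hP
    have := hγ₀ _ (show (⟨P, γ₀.δ, γ₀.isGauge, hP⟩ : FinePair a b) ∈ Ici γ₀ from fun _ => le_rfl)
    exact (Metric.mem_ball.1 this).le

theorem integrable_comap_val_iff {a b : ℝ} {φ : ℝ → ℝ} :
    Integrable (fun t : Icc a b => φ t) ((volume : Measure ℝ).comap Subtype.val) ↔
      IntegrableOn φ (Icc a b) := by
  rw [IntegrableOn, ← map_comap_subtype_coe measurableSet_Icc,
    (MeasurableEmbedding.subtype_coe measurableSet_Icc).integrable_map_iff]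
  rfl

end GenSeq

theorem theorem3 (a b : ℝ) (hab : a ≤ b) (f : Set.Icc a b → ℝ) :
    Integrable f ((volume : Measure ℝ).comap Subtype.val) ↔
      GenSeq.Converges (GenSeq.sumI f) ∧ GenSeq.Converges (GenSeq.sumJ f) := by
  obtain ⟨φ, rfl⟩ : ∃ φ : ℝ → ℝ, f = fun t : Set.Icc a b => φ t :=
    ⟨Function.extend Subtype.val f 0, funext fun t =>
      (Subtype.val_injective.extend_apply f 0 t).symm⟩
  rw [GenSeq.integrable_comap_val_iff]
  constructor
  · intro h
    exact ⟨⟨_, GenSeq.tendsto_riemannSum hab h⟩, ⟨_, GenSeq.tendsto_riemannSum hab h.abs⟩⟩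
  · rintro ⟨⟨L, hL⟩, ⟨M, hM⟩⟩
    have hp : GenSeq.HasGaugeIntegral (fun x => |φ x| + φ x) a b (M + L) := by
      refine GenSeq.hasGaugeIntegral_of_tendsto hab (fun t => rfl) ((hM.add hL).congr fun γ => ?_)
      simp [GenSeq.sumI, GenSeq.sumJ, GenSeq.riemannSum, add_mul, Finset.sum_add_distrib]
    have hm : GenSeq.HasGaugeIntegral (fun x => |φ x| - φ x) a b (M - L) := by
      refine GenSeq.hasGaugeIntegral_of_tendsto hab (fun t => rfl) ((hM.sub hL).congr fun γ => ?_)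
      simp [GenSeq.sumI, GenSeq.sumJ, GenSeq.riemannSum, sub_mul, Finset.sum_sub_distrib]
    have h1 := hp.integrableOn hab fun x => by linarith [neg_abs_le (φ x)]
    have h2 := hm.integrableOn hab fun x => by linarith [le_abs_self (φ x)]
    -- `φ = ((|φ| + φ) - (|φ| - φ)) / 2`.
    refine ((h1.sub h2).div_const 2).congr (.of_forall fun x => ?_)
    simp only [Pi.sub_apply]
    ring
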